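/- Let $Q_n$ be the $n$-dimensional hypercube: its vertices are the binary words of length $n$, two of them adjacent iff they differ in exactly one position. A vertex is even or odd according to its number of ones; call the vertices of one parity red and those of the other parity green (the statements hold for either choice). A $k$-path covering of a graph is a set of exactly $k$ vertex-disjoint paths that together contain all vertices of the graph. (a) Let $n\ge 4$, let $r_1,r_2$ be two distinct red vertices and $g_1,g_2,g_3,g_4$ four distinct green vertices of $Q_n$. Then $Q_n-\{r_1,r_2\}$ has a $2$-path covering in which one path connects $g_1$ to $g_2$ and the other connects $g_3$ to $g_4$. (b) The claim in (a) is false for $n=3$: there are two distinct red vertices $r_1,r_2$ and four distinct green vertices $g_1,\dots,g_4$ in $Q_3$ for which no such covering exists. (c) $[2,2,0,2]=4$, where the symbol is defined as follows. For a set $F$ of vertices of $Q_n$ (a fault), its mass is $|F|$ and its charge is the absolute value of the difference between its numbers of red and of green vertices. A pair of distinct vertices is charged if they have the same colour (a red or a green pair) and neutral otherwise. A set $E$ of disjoint pairs is in balance with $F$ if no pair in $E$ meets $F$ and the number of red minus the number of green vertices in $F$ equals the number of green minus the number of red pairs in $E$. One can freely prescribe ends for a path covering of $Q_n-F$ with $N$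 neutral and $O$ charged paths if there is at least one set of disjoint pairs in balance with $F$ that has exactly $N$ neutral and $O$ charged pairs, and every such set is the set of pairs of end vertices of the paths of some path covering (set of vertex-disjoint paths containing all vertices) of $Q_n-F$. Then $[M,C,N,O]$ is the smallest nonnegative integer $m\ge\log_2(M+C+2N+2O)$ such that for every $n\ge m$ and every fault $F$ of mass $M$ and charge $C$ in $Q_n$ one can freely prescribe ends for a path covering of $Q_n-F$ with $N$ neutral and $O$ charged paths. -/

import Mathlib

namespace HypercubePaths

/-- Vertices of the `n`-dimensional hypercube: binary words of length `n`. -/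
abbrev Vertex (n : ℕ) : Type := Fin n → Bool

/-- The hypercube `Q_n`: two words are adjacent iff they differ in exactly one position. -/
def cube (n : ℕ) : SimpleGraph (Vertex n) where
  Adj x y := hammingDist x y = 1
  symm := ⟨fun x y h => by rw [hammingDist_comm]; exact h⟩
  loopless := ⟨fun x h => by simp at h⟩

/-- A vertex is even (`true`) if it has an even number of ones, odd (`false`) otherwise. -/
def parity {n : ℕ} (x : Vertex n) : Bool :=
  decide (Even (Finset.univ.filter fun i => x i = true).card)

/-- A path in `G`, given with its two ends (a single vertex is a path of length `0`). -/
structure EndedPath {V : Type*} (G : SimpleGraph V) where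
  fst : V
  snd : V
  walk : G.Walk fst snd
  isPath : walk.IsPath

/-- The unordered pair of ends of a path. -/
def EndedPath.ends {V : Type*} {G : SimpleGraph V} (p : EndedPath G) : Sym2 V :=
  s(p.fst, p.snd)

/-- A path covering of `G`: a set of vertex disjoint paths that cover all vertices of `G`. -/
structure IsPathCovering {V : Type*} (G : SimpleGraph V) (C : Finset (EndedPath G)) : Prop where
  disjoint : ∀ p ∈ C, ∀ q ∈ C, p ≠ q → ∀ v, v ∈ p.walk.support → v ∉ q.walk.support
  covers : ∀ v, ∃ p ∈ C, v ∈ p.walk.support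

/-- A `k`-path covering: a path covering by exactly `k` paths. -/
def IsKPathCovering {V : Type*} (k : ℕ) (G : SimpleGraph V) (C : Finset (EndedPath G)) : Prop :=
  IsPathCovering G C ∧ C.card = k

/-- `Q_n - F`: the hypercube with the vertices of the fault `F` deleted. -/
abbrev cubeMinus {n : ℕ} (F : Finset (Vertex n)) : SimpleGraph {x : Vertex n // x ∉ F} :=
  (cube n).induce {x | x ∉ F}

/-- The ends of a path of `Q_n - F`, as vertices of `Q_n`. -/
def cubeEnds {n : ℕ} {F : Finset (Vertex n)} (p : EndedPath (cubeMinus F)) : Sym2 (Vertex n) :=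
  p.ends.map Subtype.val

/-- The claim in dimension `n`, where the vertices of parity `red` are called red and those of
the other parity green: for every two distinct red vertices and every four distinct green
vertices, the cube without the two red vertices has a 2-path covering with one path connecting
`g₁` to `g₂` and the other connecting `g₃` to `g₄`. -/
def TwoPathClaim (red : Bool) (n : ℕ) : Prop :=
  ∀ r₁ r₂ g₁ g₂ g₃ g₄ : Vertex n,
    parity r₁ = red → parity r₂ = red → r₁ ≠ r₂ →
    parity g₁ ≠ red → parity g₂ ≠ red → parity g₃ ≠ red → parity g₄ ≠ red →
    g₁ ≠ g₂ → g₁ ≠ g₃ → g₁ ≠ g₄ → g₂ ≠ g₃ → g₂ ≠ g₄ → g₃ ≠ g₄ →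
    ∃ C : Finset (EndedPath (cubeMinus ({r₁, r₂} : Finset (Vertex n)))),
      IsKPathCovering 2 (cubeMinus {r₁, r₂}) C ∧
      (∃ p ∈ C, cubeEnds p = s(g₁, g₂)) ∧ (∃ q ∈ C, cubeEnds q = s(g₃, g₄))

/-- The number of vertices of parity `b` in a fault. -/
def parityCount {n : ℕ} (b : Bool) (F : Finset (Vertex n)) : ℕ :=
  (F.filter fun x => parity x = b).card

/-- The charge of a fault: the absolute value of the difference between the numbers of its
vertices of the two parities. -/
def charge {n : ℕ} (F : Finset (Vertex n)) : ℕ :=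
  ((parityCount true F : ℤ) - (parityCount false F : ℤ)).natAbs

/-- Both elements of the pair have parity `b`. -/
def PairOfParity {n : ℕ} (b : Bool) (e : Sym2 (Vertex n)) : Prop :=
  ∀ x ∈ e, parity x = b

/-- A pair is charged if its two elements have the same parity. -/
def IsChargedPair {n : ℕ} (e : Sym2 (Vertex n)) : Prop :=
  ∃ b, PairOfParity b e

/-- A pair is neutral if its two elements have opposite parity. -/
def IsNeutralPair {n : ℕ} (e : Sym2 (Vertex n)) : Prop :=
  ∃ x ∈ e, ∃ y ∈ e, parity x ≠ parity y

/-- A set of disjoint pairs of vertices (each pair consisting of two different vertices). -/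
structure IsPairSet {n : ℕ} (E : Finset (Sym2 (Vertex n))) : Prop where
  not_diag : ∀ e ∈ E, ¬ e.IsDiag
  disjoint : ∀ e ∈ E, ∀ e' ∈ E, e ≠ e' → ∀ x, x ∈ e → x ∉ e'

/-- The number of pairs in `E` with both elements of parity `b`. -/
noncomputable def pairCount {n : ℕ} (b : Bool) (E : Finset (Sym2 (Vertex n))) : ℕ :=
  {e | e ∈ E ∧ PairOfParity b e}.ncard

/-- `E` is in balance with the fault `F`. The condition does not change when the roles of the
two parities are interchanged, so it does not matter which of them is called red. -/
def InBalance {n : ℕ} (F : Finset (Vertex n)) (E : Finset (Sym2 (Vertex n))) : Prop :=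
  (∀ e ∈ E, ∀ x ∈ e, x ∉ F) ∧
  (parityCount true F : ℤ) - parityCount false F = (pairCount false E : ℤ) - pairCount true E

/-- `E` is a set of disjoint pairs that is in balance with `F` and contains exactly `N` neutral
pairs and `O` charged pairs. -/
def IsAdmissible {n : ℕ} (F : Finset (Vertex n)) (N O : ℕ) (E : Finset (Sym2 (Vertex n))) :
    Prop :=
  IsPairSet E ∧ InBalance F E ∧
  {e | e ∈ E ∧ IsNeutralPair e}.ncard = N ∧ {e | e ∈ E ∧ IsChargedPair e}.ncard = O

/-- One can freely prescribe ends for a path covering of `Q_n - F` with `N` neutral paths and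
`O` charged paths. -/
def CanFreelyPrescribeEnds {n : ℕ} (F : Finset (Vertex n)) (N O : ℕ) : Prop :=
  (∃ E, IsAdmissible F N O E) ∧
  ∀ E, IsAdmissible F N O E →
    ∃ C : Finset (EndedPath (cubeMinus F)), IsPathCovering (cubeMinus F) C ∧
      {e | ∃ p ∈ C, cubeEnds p = e} = (E : Set (Sym2 (Vertex n)))

/-- The set whose smallest element is denoted `[M, C, N, O]`. -/
def admissibleDims (M C N O : ℕ) : Set ℕ :=
  {m | Real.logb 2 (M + C + 2 * N + 2 * O) ≤ m ∧
    ∀ n, m ≤ n → ∀ F : Finset (Vertex n), F.card = M → charge F = C →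
      CanFreelyPrescribeEnds F N O}

end HypercubePaths

namespace HypercubePaths

/-! Claim (a) is `IsTwoLaceable`, proved by induction on `n`. A coordinate in which `r₁` and `r₂`
differ splits the cube into two facets that each lose one red vertex. Each facet then has one green
vertex in excess, so it can be covered by one path with two green ends, or by such a path together
with a path whose ends have different colours. These pieces are joined along edges between the
facets; the four lemmas `isLinked_facet_*` do this for the possible distributions of the ends, using
`isLaceable`, `isHyperLaceable` and `IsTwoLaceable.exists_neutral`. The base case `n = 4` is a
verified search, after a translation sending `r₁` to the zero word. Throughout, paths are lists of
vertices, and one multiset equality with `Finset.univ.val` expresses both disjointness and covering,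
so that gluing is checked by counting. For (b), the two red vertices leave `g₁` with a single
neighbour `s`, whose other neighbours are `g₃` and `g₄`; a path from `g₁` to `g₂` cannot get past
`s`. For (c), a fault of mass and charge 2 is a pair of vertices of one colour, and balance forces
both charged pairs to have the other colour. So (a) gives the bound 4, and (b) excludes 3. -/

/-! ### Parity and adjacency in the hypercube -/

/-- As a sum in `ZMod 2` the parity is additive in the coordinates, which reduces Hamming distances
and inserted coordinates to finite checks. -/
theorem parity_eq_iff_sum {n : ℕ} (x : Vertex n) :
    parity x = decide (∑ i, ((x i).toNat : ZMod 2) = 0) := by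
  have h : (∑ i, ((x i).toNat : ZMod 2)) =
      ((Finset.univ.filter fun i => x i = true).card : ZMod 2) := by
    rw [Finset.card_filter, Nat.cast_sum]
    exact Finset.sum_congr rfl fun i _ => by cases x i <;> simp
  unfold parity
  rw [h, decide_eq_decide, ZMod.natCast_eq_zero_iff_even]

theorem parity_eq_parity_iff {n : ℕ} (x y : Vertex n) :
    parity x = parity y ↔ Even (hammingDist x y) := by
  have h : (∑ i, ((x i).toNat : ZMod 2)) + ∑ i, ((y i).toNat : ZMod 2) =
      (hammingDist x y : ZMod 2) := by
    rw [hammingDist, Finset.card_filter, Nat.cast_sum, ← Finset.sum_add_distrib]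
    refine Finset.sum_congr rfl fun i _ => ?_
    cases x i <;> cases y i <;> simp
    decide
  rw [← ZMod.natCast_eq_zero_iff_even, ← h, parity_eq_iff_sum, parity_eq_iff_sum, decide_eq_decide]
  generalize (∑ i, ((x i).toNat : ZMod 2)) = a
  generalize (∑ i, ((y i).toNat : ZMod 2)) = b
  revert a b
  decide

theorem cube_adj {n : ℕ} {x y : Vertex n} : (cube n).Adj x y ↔ hammingDist x y = 1 := Iff.rfl

instance (n : ℕ) : DecidableRel (cube n).Adj := fun x y =>
  inferInstanceAs (Decidable (hammingDist x y = 1))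

theorem parity_ne_of_adj {n : ℕ} {x y : Vertex n} (h : (cube n).Adj x y) :
    parity x ≠ parity y := by
  rw [Ne, parity_eq_parity_iff, cube_adj.1 h]
  decide

/-- The neighbour of `x` in direction `i`. -/
def flip {n : ℕ} (x : Vertex n) (i : Fin n) : Vertex n := Function.update x i (!x i)

theorem adj_flip {n : ℕ} (x : Vertex n) (i : Fin n) : (cube n).Adj x (flip x i) := by
  rw [cube_adj, hammingDist, Finset.card_eq_one]
  refine ⟨i, ?_⟩
  ext j
  by_cases h : j = i
  · subst h; exact iff_of_true (Finset.mem_filter.2 ⟨Finset.mem_univ _, by simp [flip]⟩) (by simp)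
  · refine iff_of_false (fun hj => (Finset.mem_filter.1 hj).2 ?_) (by simpa using h)
    simp [flip, h]

theorem flip_injective {n : ℕ} (x : Vertex n) : Function.Injective (flip x) := by
  intro i j h
  by_contra hij
  have := congrFun h i
  simp [flip, hij] at this

/-- A vertex of `Q_n` has a neighbour outside any set of fewer than `n` vertices. -/
theorem exists_adj_notMem {n : ℕ} (x : Vertex n) (L : Finset (Vertex n)) (hL : L.card < n) :
    ∃ y, (cube n).Adj x y ∧ y ∉ L := by
  obtain ⟨y, hy, hyL⟩ := Finset.exists_mem_notMem_of_card_lt_card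
    (s := L) (t := Finset.univ.image (flip x))
    (by rw [Finset.card_image_of_injective _ (flip_injective x)]; simpa using hL)
  obtain ⟨i, -, rfl⟩ := Finset.mem_image.1 hy
  exact ⟨_, adj_flip x i, hyL⟩

/-! ### Splitting the cube along a coordinate -/

/-- The embedding of `Q_n` as a facet of `Q_{n+1}`. -/
def facet {n : ℕ} (i : Fin (n + 1)) (b : Bool) (x : Vertex n) : Vertex (n + 1) :=
  i.insertNth b x

theorem exists_facet {n : ℕ} (i : Fin (n + 1)) (x : Vertex (n + 1)) :
    ∃ y, x = facet i (x i) y :=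
  ⟨i.removeNth x, (Fin.insertNth_self_removeNth i x).symm⟩

theorem facet_injective {n : ℕ} (i : Fin (n + 1)) (b : Bool) :
    Function.Injective (facet i b : Vertex n → _) :=
  fun _ _ h => Fin.insertNth_right_injective (α := fun _ => Bool) (p := i) b h

theorem hammingDist_facet {n : ℕ} (i : Fin (n + 1)) (b c : Bool) (x y : Vertex n) :
    hammingDist (facet i b x) (facet i c y) = (if b = c then 0 else 1) + hammingDist x y := by
  simp only [hammingDist, Finset.card_filter]
  rw [Fin.sum_univ_succAbove _ i]
  simp [facet]

theorem facet_adj {n : ℕ} (i : Fin (n + 1)) (b : Bool) {x y : Vertex n} :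
    (cube (n + 1)).Adj (facet i b x) (facet i b y) ↔ (cube n).Adj x y := by
  simp [cube_adj, hammingDist_facet]

theorem facet_adj_facet_not {n : ℕ} (i : Fin (n + 1)) (b : Bool) (x : Vertex n) :
    (cube (n + 1)).Adj (facet i b x) (facet i (!b) x) := by
  simp [cube_adj, hammingDist_facet]

theorem parity_facet {n : ℕ} (i : Fin (n + 1)) (b : Bool) (x : Vertex n) :
    parity (facet i b x) = (b ^^ parity x) := by
  rw [parity_eq_iff_sum, parity_eq_iff_sum, Fin.sum_univ_succAbove _ i]
  simp only [facet, Fin.insertNth_apply_same, Fin.insertNth_apply_succAbove]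
  generalize (∑ j, ((x j).toNat : ZMod 2)) = a
  revert a b
  decide

/-- The vertices of the two facets, as multisets. -/
theorem univ_val_facet {n : ℕ} (i : Fin (n + 1)) (b : Bool) :
    (Finset.univ : Finset (Vertex (n + 1))).val =
      (Finset.univ : Finset (Vertex n)).val.map (facet i b) +
        (Finset.univ : Finset (Vertex n)).val.map (facet i (!b)) := by
  classical
  have hd : Disjoint (Finset.univ.map ⟨_, facet_injective (n := n) i b⟩)
      (Finset.univ.map ⟨_, facet_injective (n := n) i (!b)⟩) := by
    rw [Finset.disjoint_left]
    intro x hx hx'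
    simp only [Finset.mem_map, Finset.mem_univ, true_and, Function.Embedding.coeFn_mk] at hx hx'
    obtain ⟨y, rfl⟩ := hx
    obtain ⟨z, hz⟩ := hx'
    have := congrFun hz i
    simp [facet] at this
  have h : (Finset.univ : Finset (Vertex (n + 1))) = Finset.disjUnion _ _ hd := by
    symm
    rw [Finset.eq_univ_iff_forall]
    intro x
    obtain ⟨y, hy⟩ := exists_facet i x
    simp only [Finset.mem_disjUnion, Finset.mem_map, Finset.mem_univ, true_and,
      Function.Embedding.coeFn_mk]
    by_cases hb : x i = b
    · exact Or.inl ⟨y, by rw [← hb, ← hy]⟩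
    · exact Or.inr ⟨y, by rw [← Bool.eq_not_of_ne hb, ← hy]⟩
  rw [h]
  rfl

/-! ### Paths as lists of vertices -/

/-- `l` lists the vertices of a walk from `u` to `v`. -/
structure Links {V : Type*} (G : SimpleGraph V) (l : List V) (u v : V) : Prop where
  chain : l.IsChain G.Adj
  head : l.head? = some u
  last : l.getLast? = some v

namespace Links

variable {V W : Type*} {G : SimpleGraph V} {H : SimpleGraph W} {l l' : List V} {u v w x : V}

theorem singleton (u : V) : Links G [u] u u := ⟨by simp, by simp, by simp⟩

theorem append (h : Links G l u v) (h' : Links G l' w x) (ha : G.Adj v w) :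
    Links G (l ++ l') u x := by
  refine ⟨?_, by simp [h.head], by simp [h'.last]⟩
  rw [List.isChain_append]
  refine ⟨h.chain, h'.chain, ?_⟩
  simp [h.last, h'.head, ha]

theorem reverse (h : Links G l u v) : Links G l.reverse v u := by
  refine ⟨?_, by simp [h.last], by simp [h.head]⟩
  rw [List.isChain_reverse]
  exact h.chain.imp fun _ _ => G.adj_symm

theorem map (f : V → W) (hf : ∀ a b, G.Adj a b → H.Adj (f a) (f b)) (h : Links G l u v) :
    Links H (l.map f) (f u) (f v) := by
  refine ⟨?_, by simp [h.head], by simp [h.last]⟩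
  rw [List.isChain_map]
  exact h.chain.imp hf

theorem facet {n : ℕ} {l : List (Vertex n)} {u v : Vertex n} (h : Links (cube n) l u v)
    (i : Fin (n + 1)) (b : Bool) :
    Links (cube (n + 1)) (l.map (facet i b)) (facet i b u) (facet i b v) :=
  h.map _ fun _ _ => (facet_adj i b).2

/-- The first edge of a walk with different ends. -/
theorem exists_cons (h : Links G l u v) (huv : u ≠ v) :
    ∃ c t, l = u :: t ∧ G.Adj u c ∧ Links G t c v := by
  match l, h with
  | [], h => exact absurd h.head (by simp)
  | [a], h =>
    exact absurd ((Option.some.inj h.head).symm.trans (Option.some.inj h.last)) huv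
  | a :: c :: t, h =>
    obtain rfl : a = u := Option.some.inj h.head
    obtain ⟨ha, ht⟩ := List.isChain_cons_cons.1 h.chain
    exact ⟨c, c :: t, rfl, ha, ht, rfl, by simpa using h.last⟩

end Links

/-! ### Hamiltonian paths with prescribed ends in `Q_n` and `Q_n - r` -/

theorem parity_facet_eq {n : ℕ} (i : Fin (n + 1)) (b : Bool) (x y : Vertex n) :
    parity (facet i b x) = parity (facet i b y) ↔ parity x = parity y := by
  simp [parity_facet]

/-- Crossing between facets changes the colour but not the word in `Q_n`. Hence a red end of a piece
in one facet is continued from a green vertex in the other, and conversely. -/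
theorem parity_facet_not_eq {n : ℕ} (i : Fin (n + 1)) (b : Bool) (x y : Vertex n) :
    parity (facet i (!b) x) = parity (facet i b y) ↔ parity x ≠ parity y := by
  rw [parity_facet, parity_facet]
  generalize parity x = p
  generalize parity y = q
  revert b p q
  decide

theorem bool_eq_of_ne_of_ne {p q s : Bool} (hp : p ≠ s) (hq : q ≠ s) : p = q :=
  (Bool.eq_not_of_ne hp).trans (Bool.eq_not_of_ne hq).symm

/-- Two vertices of opposite parity are the ends of a Hamiltonian path of `Q_n`. -/
def IsLaceable (n : ℕ) : Prop :=
  ∀ u v : Vertex n, parity u ≠ parity v →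
    ∃ l, Links (cube n) l u v ∧ (l : Multiset (Vertex n)) = Finset.univ.val

/-- Two vertices of the parity opposite to `r` are the ends of a Hamiltonian path of `Q_n - r`. -/
def IsHyperLaceable (n : ℕ) : Prop :=
  ∀ r u v : Vertex n, parity u ≠ parity r → parity v ≠ parity r → u ≠ v →
    ∃ l, Links (cube n) l u v ∧ ((r :: l : List _) : Multiset (Vertex n)) = Finset.univ.val

/-- Equality of the vertex multisets reduces to a count on each of the two facets. -/
theorem coe_eq_univ_of_facets {n : ℕ} (i : Fin (n + 1)) (b : Bool) {L : List (Vertex (n + 1))}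
    {l l' : List (Vertex n)} (h : (l : Multiset (Vertex n)) = Finset.univ.val)
    (h' : (l' : Multiset (Vertex n)) = Finset.univ.val)
    (hL : ∀ x, L.count x = (l.map (facet i b)).count x + (l'.map (facet i (!b))).count x) :
    (L : Multiset (Vertex (n + 1))) = Finset.univ.val := by
  rw [univ_val_facet i b]
  nth_rewrite 1 [← h]
  rw [← h', Multiset.map_coe, Multiset.map_coe, Multiset.coe_add, Multiset.coe_eq_coe,
    List.perm_iff_count]
  intro x
  rw [hL, List.count_append]

theorem exists_coord_ne {n : ℕ} {x y : Vertex n} (h : x ≠ y) : ∃ i, y i = !x i := by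
  obtain ⟨i, hi⟩ := Function.ne_iff.1 h
  exact ⟨i, Bool.eq_not_of_ne (Ne.symm hi)⟩

/-- With `u` and `v` in opposite facets, their words in `Q_n` have equal parity. Any neighbour `w`
of `u'` therefore serves as crossing point: one facet is traversed from `u'` to `w`, the other from
`w` to `v'`. -/
theorem isLaceable_succ {n : ℕ} (hn : 1 ≤ n) (h : IsLaceable n) : IsLaceable (n + 1) := by
  intro u v huv
  obtain ⟨i, hi⟩ := exists_coord_ne (fun he : u = v => huv (by rw [he]))
  obtain ⟨u', hu⟩ := exists_facet i u
  obtain ⟨v', hv⟩ := exists_facet i v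
  rw [hi] at hv
  generalize u i = b at *
  subst hu hv
  obtain ⟨w, hw, -⟩ := exists_adj_notMem u' ∅ (by simpa using Nat.succ_le_iff.1 hn)
  have hw' := parity_ne_of_adj hw
  rw [ne_comm, Ne, parity_facet_not_eq, not_not] at huv
  obtain ⟨l, hl, hlu⟩ := h u' w hw'
  obtain ⟨l', hl', hlu'⟩ := h w v' (by rw [huv]; exact hw'.symm)
  refine ⟨_, (hl.facet i b).append (hl'.facet i (!b)) (facet_adj_facet_not i b w),
    coe_eq_univ_of_facets i b hlu hlu' fun x => by rw [List.count_append]⟩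

theorem isLaceable {n : ℕ} (hn : 1 ≤ n) : IsLaceable n := by
  induction n, hn using Nat.le_induction with
  | base =>
    have h : ∀ u v : Vertex 1, parity u ≠ parity v → (cube 1).Adj u v ∧
      (([u, v] : List _) : Multiset (Vertex 1)) = Finset.univ.val := by decide
    intro u v huv
    exact ⟨_, (Links.singleton u).append (Links.singleton v) (h u v huv).1, (h u v huv).2⟩
  | succ n hn ih => exact isLaceable_succ hn ih

/-- A coordinate separating `u` from `v` puts `r` in the facet of exactly one of them. That facet is
covered without `r` by the induction hypothesis, the other one by laceability; `key` is the case
where `r` is with the first end, and reversal gives the other. -/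
theorem isHyperLaceable_succ {n : ℕ} (hn : 2 ≤ n) (h : IsHyperLaceable n) :
    IsHyperLaceable (n + 1) := by
  have key : ∀ (i : Fin (n + 1)) (b : Bool) (r u v : Vertex n),
      parity (facet i b u) ≠ parity (facet i b r) →
      parity (facet i (!b) v) ≠ parity (facet i b r) →
      ∃ l, Links (cube (n + 1)) l (facet i b u) (facet i (!b) v) ∧
        ((facet i b r :: l : List _) : Multiset (Vertex (n + 1))) = Finset.univ.val := by
    intro i b r u v hu hv
    rw [Ne, parity_facet_eq] at hu
    rw [Ne, parity_facet_not_eq, not_not] at hv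
    obtain ⟨w, hw, hwu⟩ := exists_adj_notMem r {u} (by rw [Finset.card_singleton]; omega)
    have hw' := parity_ne_of_adj hw
    obtain ⟨l, hl, hlu⟩ := h r u w hu hw'.symm (by simpa [eq_comm] using hwu)
    obtain ⟨l', hl', hlu'⟩ := isLaceable (by omega) w v (by rw [hv]; exact hw'.symm)
    refine ⟨_, (hl.facet i b).append (hl'.facet i (!b)) (facet_adj_facet_not i b w),
      coe_eq_univ_of_facets i b hlu hlu' fun x => ?_⟩
    simp only [List.map_cons, List.count_cons, List.count_append]
    omega
  intro r u v hu hv huv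
  obtain ⟨i, hi⟩ := exists_coord_ne huv
  obtain ⟨r', hr'⟩ := exists_facet i r
  obtain ⟨u', hu'⟩ := exists_facet i u
  obtain ⟨v', hv'⟩ := exists_facet i v
  by_cases hb : r i = u i
  · rw [hb] at hr'
    rw [hi] at hv'
    generalize u i = t at *
    subst hr' hu' hv'
    exact key i t r' u' v' hu hv
  · have hb' := Bool.eq_not_of_ne hb
    rw [hb', ← hi] at hr'
    rw [show u i = !v i by simp [hi]] at hu'
    clear hi hb hb'
    generalize v i = t at *
    subst hr' hu' hv'
    obtain ⟨l, hl, hlu⟩ := key i t r' v' u' hv hu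
    refine ⟨_, hl.reverse, hlu ▸ ?_⟩
    simp

theorem isHyperLaceable {n : ℕ} (hn : 2 ≤ n) : IsHyperLaceable n := by
  induction n, hn using Nat.le_induction with
  | base =>
    -- In the 4-cycle, `u` and `v` are the two neighbours of `r`, and the path runs through the
    -- antipode of `r`.
    have h : ∀ r u v : Vertex 2, parity u ≠ parity r → parity v ≠ parity r → u ≠ v →
        (cube 2).Adj u (fun i => !r i) ∧ (cube 2).Adj (fun i => !r i) v ∧
        (([r, u, fun i => !r i, v] : List _) : Multiset (Vertex 2)) = Finset.univ.val := by
      decide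
    intro r u v hu hv huv
    obtain ⟨h₁, h₂, h₃⟩ := h r u v hu hv huv
    exact ⟨_, (Links.singleton u).append ((Links.singleton _).append (Links.singleton v) h₂) h₁, h₃⟩
  | succ n hn ih => exact isHyperLaceable_succ hn ih

/-! ### Covering the cube without two vertices by two paths -/

/-- Deleted vertices `r₁`, `r₂` of the same parity, and prescribed ends `a`, `b` and `c`, `d` of
the other parity. -/
structure IsEndChoice {n : ℕ} (r₁ r₂ a b c d : Vertex n) : Prop where
  ne : r₁ ≠ r₂
  parity_eq : parity r₁ = parity r₂
  parity_a : parity a ≠ parity r₁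
  parity_b : parity b ≠ parity r₁
  parity_c : parity c ≠ parity r₁
  parity_d : parity d ≠ parity r₁
  nodup : [a, b, c, d].Nodup

/-- `Q_n` without `r₁`, `r₂` is covered by a path from `a` to `b` and a path from `c` to `d`. -/
def IsLinked {n : ℕ} (r₁ r₂ a b c d : Vertex n) : Prop :=
  ∃ l l', Links (cube n) l a b ∧ Links (cube n) l' c d ∧
    ((r₁ :: r₂ :: (l ++ l') : List _) : Multiset (Vertex n)) = Finset.univ.val

/-- All choices of deleted vertices and ends in `Q_n` can be linked. -/
def IsTwoLaceable (n : ℕ) : Prop :=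
  ∀ r₁ r₂ a b c d : Vertex n, IsEndChoice r₁ r₂ a b c d → IsLinked r₁ r₂ a b c d

section symmetry

variable {n : ℕ} {r₁ r₂ a b c d : Vertex n}

theorem IsEndChoice.swap_deleted (h : IsEndChoice r₁ r₂ a b c d) : IsEndChoice r₂ r₁ a b c d := by
  obtain ⟨h₁, h₂, h₃, h₄, h₅, h₆, h₇⟩ := h
  rw [h₂] at h₃ h₄ h₅ h₆
  exact ⟨h₁.symm, h₂.symm, h₃, h₄, h₅, h₆, h₇⟩

theorem IsEndChoice.swap_left (h : IsEndChoice r₁ r₂ a b c d) : IsEndChoice r₁ r₂ b a c d :=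
  ⟨h.ne, h.parity_eq, h.parity_b, h.parity_a, h.parity_c, h.parity_d, by grind [h.nodup]⟩

theorem IsEndChoice.swap_pairs (h : IsEndChoice r₁ r₂ a b c d) : IsEndChoice r₁ r₂ c d a b :=
  ⟨h.ne, h.parity_eq, h.parity_c, h.parity_d, h.parity_a, h.parity_b, by grind [h.nodup]⟩

theorem IsLinked.swap_deleted (h : IsLinked r₁ r₂ a b c d) : IsLinked r₂ r₁ a b c d := by
  obtain ⟨l, l', hl, hl', hu⟩ := h
  exact ⟨l, l', hl, hl', hu ▸ Multiset.coe_eq_coe.2 (List.Perm.swap _ _ _)⟩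

theorem IsLinked.swap_left (h : IsLinked r₁ r₂ a b c d) : IsLinked r₁ r₂ b a c d := by
  obtain ⟨l, l', hl, hl', hu⟩ := h
  refine ⟨_, l', hl.reverse, hl', hu ▸ Multiset.coe_eq_coe.2 ?_⟩
  exact (((List.reverse_perm l).append_right l').cons _).cons _

theorem IsLinked.swap_pairs (h : IsLinked r₁ r₂ a b c d) : IsLinked r₁ r₂ c d a b := by
  obtain ⟨l, l', hl, hl', hu⟩ := h
  exact ⟨l', l, hl', hl, hu ▸ Multiset.coe_eq_coe.2 ((List.perm_append_comm.cons _).cons _)⟩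

end symmetry

/-- In a cube where all ends can be linked, `Q_n - r` is covered by a path with ends `a`, `b` of
the parity opposite to `r` and a path with ends `c`, `s` of different parity. -/
theorem IsTwoLaceable.exists_neutral {n : ℕ} (h : IsTwoLaceable n) (hn : 4 ≤ n)
    {r s a b c : Vertex n} (hrs : r ≠ s) (hp : parity r = parity s) (ha : parity a ≠ parity r)
    (hb : parity b ≠ parity r) (hc : parity c ≠ parity r) (hab : a ≠ b) (hac : a ≠ c)
    (hbc : b ≠ c) :
    ∃ l l', Links (cube n) l a b ∧ Links (cube n) l' c s ∧
      ((r :: (l ++ l') : List _) : Multiset (Vertex n)) = Finset.univ.val := by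
  -- Besides `r`, the end `s` is deleted too, and is afterwards appended to a path ending at its
  -- neighbour `d`.
  obtain ⟨d, hd, hd'⟩ := exists_adj_notMem s {a, b, c}
    (Finset.card_le_three.trans_lt (by omega))
  obtain ⟨l, l', hl, hl', hu⟩ := h r s a b c d
    ⟨hrs, hp, ha, hb, hc, by rw [hp]; exact (parity_ne_of_adj hd).symm, by grind⟩
  refine ⟨l, _, hl, hl'.append (Links.singleton s) hd.symm, hu ▸ Multiset.coe_eq_coe.2 ?_⟩
  rw [List.perm_iff_count]
  intro x
  simp only [List.count_cons, List.count_append, List.count_nil]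
  omega

/-! ### The induction step, by the distribution of the four ends over the facets -/

section step

variable {n : ℕ} {i : Fin (n + 1)} {t : Bool} {r₁ r₂ a b c d : Vertex n}

theorem isLinked_facet_two_two (hn : 4 ≤ n)
    (hE : IsEndChoice (facet i t r₁) (facet i (!t) r₂) (facet i t a) (facet i t b)
      (facet i (!t) c) (facet i (!t) d)) :
    IsLinked (facet i t r₁) (facet i (!t) r₂) (facet i t a) (facet i t b)
      (facet i (!t) c) (facet i (!t) d) := by
  obtain ⟨-, hr, ha, hb, hc, hd, hnd⟩ := hE
  rw [hr] at hc hd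
  simp only [Ne, parity_facet_eq] at ha hb hc hd
  obtain ⟨l, hl, hu⟩ := isHyperLaceable (by omega) r₁ a b ha hb (by grind)
  obtain ⟨l', hl', hu'⟩ := isHyperLaceable (by omega) r₂ c d hc hd (by grind)
  refine ⟨_, _, hl.facet i t, hl'.facet i (!t), coe_eq_univ_of_facets i t hu hu' fun x => ?_⟩
  simp only [List.map_cons, List.count_cons, List.count_append]
  omega

theorem isLinked_facet_crossing (hn : 4 ≤ n) (h : IsTwoLaceable n)
    (hE : IsEndChoice (facet i t r₁) (facet i (!t) r₂) (facet i t a) (facet i (!t) b)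
      (facet i t c) (facet i (!t) d)) :
    IsLinked (facet i t r₁) (facet i (!t) r₂) (facet i t a) (facet i (!t) b)
      (facet i t c) (facet i (!t) d) := by
  obtain ⟨-, hr, ha, hb, hc, hd, hnd⟩ := hE
  rw [eq_comm, parity_facet_not_eq] at hr
  simp only [Ne, parity_facet_eq, parity_facet_not_eq, not_not] at ha hb hc hd
  -- The path from `a` to `b` will cross at `p`, the one from `c` to `d` at `q`. In the first facet
  -- `p` is red and `q` green, in the second the reverse, so each facet gets one neutral and one
  -- charged path. Adjacency only serves to fix the colours; the avoided vertices keep all ends and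
  -- deleted vertices distinct.
  obtain ⟨p, hp, hp'⟩ := exists_adj_notMem a {r₁, b, d}
    (Finset.card_le_three.trans_lt (by omega))
  obtain ⟨q, hq, hq'⟩ := exists_adj_notMem r₁ {a, c, r₂}
    (Finset.card_le_three.trans_lt (by omega))
  have hpp : parity p = parity r₁ := bool_eq_of_ne_of_ne (parity_ne_of_adj hp).symm (Ne.symm ha)
  have hqq := parity_ne_of_adj hq
  have hqr : parity q = parity r₂ := bool_eq_of_ne_of_ne hqq.symm hr
  have hac : a ≠ c := by rintro rfl; simp at hnd
  have hbd : b ≠ d := by rintro rfl; simp at hnd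
  clear hnd
  simp only [Finset.mem_insert, Finset.mem_singleton, not_or] at hp' hq'
  obtain ⟨l, l', hl, hl', hu⟩ := h.exists_neutral hn (r := r₁) (s := p) (a := c) (b := q) (c := a)
    (by grind) (by grind) (by grind) (by grind) (by grind) (by grind) (by grind) (by grind)
  obtain ⟨m, m', hm, hm', hv⟩ := h.exists_neutral hn (r := r₂) (s := q) (a := p) (b := b) (c := d)
    (by grind) (by grind) (by grind) (by grind) (by grind) (by grind) (by grind) (by grind)
  refine ⟨_, _, (hl'.facet i t).append (hm.facet i (!t)) (facet_adj_facet_not i t p),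
    (hl.facet i t).append (hm'.reverse.facet i (!t)) (facet_adj_facet_not i t q),
    coe_eq_univ_of_facets i t hu hv fun x => ?_⟩
  simp only [List.map_cons, List.count_cons, List.count_append, List.map_append, List.map_reverse,
    List.count_reverse]
  omega

/-- The first facet is linked with an extra red neighbour `s` of `a` deleted. The first edge from
`a` to `p` is then replaced by a detour: from `a` to `s`, across, through the whole other facet
without `r₂`, and back to `p`. -/
theorem isLinked_facet_four (hn : 4 ≤ n) (h : IsTwoLaceable n)
    (hE : IsEndChoice (facet i t r₁) (facet i (!t) r₂) (facet i t a) (facet i t b)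
      (facet i t c) (facet i t d)) :
    IsLinked (facet i t r₁) (facet i (!t) r₂) (facet i t a) (facet i t b)
      (facet i t c) (facet i t d) := by
  obtain ⟨-, hr, ha, hb, hc, hd, hnd⟩ := hE
  rw [eq_comm, parity_facet_not_eq] at hr
  simp only [Ne, parity_facet_eq] at ha hb hc hd
  obtain ⟨s, hs, hs'⟩ := exists_adj_notMem a {r₁} (by rw [Finset.card_singleton]; omega)
  have hss : parity s = parity r₁ := bool_eq_of_ne_of_ne (parity_ne_of_adj hs).symm (Ne.symm ha)
  obtain ⟨l, l', hl, hl', hu⟩ := h r₁ s a b c d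
    ⟨by simpa [eq_comm] using hs', hss.symm, ha, hb, hc, hd, List.Nodup.of_map (facet i t) hnd⟩
  obtain ⟨p, m, rfl, hp, hm⟩ := hl.exists_cons (by rintro rfl; simp at hnd)
  have hpp : parity p = parity r₁ := bool_eq_of_ne_of_ne (parity_ne_of_adj hp).symm (Ne.symm ha)
  have hsp : s ≠ p := by
    rintro rfl
    have hnd' : (r₁ :: s :: (a :: m ++ l')).Nodup := by
      rw [← Multiset.coe_nodup, hu]
      exact Finset.univ.nodup
    have : s ∈ m := List.mem_of_mem_head? hm.head
    grind
  obtain ⟨k, hk, hv⟩ := isHyperLaceable (by omega) r₂ s p (by grind) (by grind) hsp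
  refine ⟨_, _, (Links.singleton (facet i t a)).append ((Links.singleton (facet i t s)).append
      ((hk.facet i (!t)).append (hm.facet i t) ((facet_adj_facet_not i t p).symm))
      (facet_adj_facet_not i t s)) ((facet_adj i t).2 hs), hl'.facet i t,
    coe_eq_univ_of_facets i t hu hv fun x => ?_⟩
  simp only [List.map_cons, List.count_cons, List.count_append, List.map_append, List.count_nil]
  omega

theorem isLinked_facet_three (hn : 4 ≤ n) (h : IsTwoLaceable n)
    (hE : IsEndChoice (facet i t r₁) (facet i (!t) r₂) (facet i t a) (facet i t b)
      (facet i t c) (facet i (!t) d)) :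
    IsLinked (facet i t r₁) (facet i (!t) r₂) (facet i t a) (facet i t b)
      (facet i t c) (facet i (!t) d) := by
  obtain ⟨-, hr, ha, hb, hc, hd, hnd⟩ := hE
  rw [eq_comm, parity_facet_not_eq] at hr
  simp only [Ne, parity_facet_eq, parity_facet_not_eq, not_not] at ha hb hc hd
  -- The path from `c` to `d` crosses at `s`, which is red in the first facet and green in the
  -- second.
  obtain ⟨s, hs, hs'⟩ := exists_adj_notMem a {r₁, d} (Finset.card_le_two.trans_lt (by omega))
  have hss : parity s = parity r₁ := bool_eq_of_ne_of_ne (parity_ne_of_adj hs).symm (Ne.symm ha)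
  have hab : a ≠ b := by rintro rfl; simp at hnd
  have hac : a ≠ c := by rintro rfl; simp at hnd
  have hbc : b ≠ c := by rintro rfl; simp at hnd
  clear hnd
  simp only [Finset.mem_insert, Finset.mem_singleton, not_or] at hs'
  obtain ⟨l, l', hl, hl', hu⟩ := h.exists_neutral hn (r := r₁) (s := s) (a := a) (b := b) (c := c)
    (by grind) (by grind) (by grind) (by grind) (by grind) (by grind) (by grind) (by grind)
  obtain ⟨k, hk, hv⟩ := isHyperLaceable (by omega) r₂ s d (by grind) (by grind) (by grind)
  refine ⟨_, _, hl.facet i t, (hl'.facet i t).append (hk.facet i (!t)) (facet_adj_facet_not i t s),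
    coe_eq_univ_of_facets i t hu hv fun x => ?_⟩
  simp only [List.map_cons, List.count_cons, List.count_append, List.map_append]
  omega

end step

theorem isTwoLaceable_succ {n : ℕ} (hn : 4 ≤ n) (h : IsTwoLaceable n) :
    IsTwoLaceable (n + 1) := by
  intro r₁ r₂ a b c d hE
  obtain ⟨i, hi⟩ := exists_coord_ne hE.ne
  -- it suffices to treat the case where at least two ends lie on the facet of `r₁`
  have three : ∀ (t : Bool) (r₁ r₂ : Vertex n) (a b c d : Vertex (n + 1)),
      IsEndChoice (facet i t r₁) (facet i (!t) r₂) a b c d → a i = t → b i = t → c i = t →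
      IsLinked (facet i t r₁) (facet i (!t) r₂) a b c d := by
    intro t r₁ r₂ a b c d hE ha hb hc
    obtain ⟨a', ha'⟩ := exists_facet i a
    obtain ⟨b', hb'⟩ := exists_facet i b
    obtain ⟨c', hc'⟩ := exists_facet i c
    obtain ⟨d', hd'⟩ := exists_facet i d
    rw [ha] at ha'
    rw [hb] at hb'
    rw [hc] at hc'
    subst ha' hb' hc'
    by_cases hd : d i = t
    · rw [hd] at hd'
      subst hd'
      exact isLinked_facet_four hn h hE
    · rw [Bool.eq_not_of_ne hd] at hd'
      subst hd'
      exact isLinked_facet_three hn h hE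
  have two : ∀ (t : Bool) (r₁ r₂ : Vertex n) (a b c d : Vertex (n + 1)),
      IsEndChoice (facet i t r₁) (facet i (!t) r₂) a b c d → a i = t → b i = t →
      IsLinked (facet i t r₁) (facet i (!t) r₂) a b c d := by
    intro t r₁ r₂ a b c d hE ha hb
    by_cases hc : c i = t
    · exact three t r₁ r₂ a b c d hE ha hb hc
    by_cases hd : d i = t
    · exact (three t r₁ r₂ a b d c hE.swap_pairs.swap_left.swap_pairs ha hb
        hd).swap_pairs.swap_left.swap_pairs
    obtain ⟨a', ha'⟩ := exists_facet i a
    obtain ⟨b', hb'⟩ := exists_facet i b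
    obtain ⟨c', hc'⟩ := exists_facet i c
    obtain ⟨d', hd'⟩ := exists_facet i d
    rw [ha] at ha'
    rw [hb] at hb'
    rw [Bool.eq_not_of_ne hc] at hc'
    rw [Bool.eq_not_of_ne hd] at hd'
    subst ha' hb' hc' hd'
    exact isLinked_facet_two_two hn hE
  -- one end of each path on either facet
  have cross : ∀ (t : Bool) (r₁ r₂ : Vertex n) (a b c d : Vertex (n + 1)),
      IsEndChoice (facet i t r₁) (facet i (!t) r₂) a b c d → a i = t → b i = (!t) → c i = t →
      d i = (!t) → IsLinked (facet i t r₁) (facet i (!t) r₂) a b c d := by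
    intro t r₁ r₂ a b c d hE ha hb hc hd
    obtain ⟨a', ha'⟩ := exists_facet i a
    obtain ⟨b', hb'⟩ := exists_facet i b
    obtain ⟨c', hc'⟩ := exists_facet i c
    obtain ⟨d', hd'⟩ := exists_facet i d
    rw [ha] at ha'
    rw [hb] at hb'
    rw [hc] at hc'
    rw [hd] at hd'
    subst ha' hb' hc' hd'
    exact isLinked_facet_crossing hn h hE
  -- If one path has both ends in a facet, the deleted vertex of that facet may be called the first
  -- one.
  have pair : ∀ (a b c d : Vertex (n + 1)), IsEndChoice r₁ r₂ a b c d → a i = b i →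
      IsLinked r₁ r₂ a b c d := by
    intro a b c d hE hab
    obtain ⟨s₁, hs₁⟩ := exists_facet i r₁
    obtain ⟨s₂, hs₂⟩ := exists_facet i r₂
    by_cases ha : a i = r₁ i
    · rw [hi] at hs₂
      generalize r₁ i = t at *
      subst hs₁ hs₂
      exact two t s₁ s₂ a b c d hE ha (hab ▸ ha)
    · rw [show r₁ i = !r₂ i by simp [hi]] at hs₁
      have ha' : a i = r₂ i := by rw [hi]; exact Bool.eq_not_of_ne ha
      clear hi ha
      generalize r₂ i = t at *
      subst hs₁ hs₂
      exact (two t s₂ s₁ a b c d hE.swap_deleted ha' (hab ▸ ha')).swap_deleted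
  by_cases hab : a i = b i
  · exact pair a b c d hE hab
  by_cases hcd : c i = d i
  · exact (pair c d a b hE.swap_pairs hcd).swap_pairs
  have fin : ∀ (a b c d : Vertex (n + 1)), IsEndChoice r₁ r₂ a b c d → a i = r₁ i →
      b i = (!r₁ i) → c i = r₁ i → d i = (!r₁ i) → IsLinked r₁ r₂ a b c d := by
    intro a b c d hE
    obtain ⟨s₁, hs₁⟩ := exists_facet i r₁
    obtain ⟨s₂, hs₂⟩ := exists_facet i r₂
    rw [hi] at hs₂
    generalize r₁ i = t at *
    subst hs₁ hs₂
    exact cross t s₁ s₂ a b c d hE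
  have hb := Bool.eq_not_of_ne (Ne.symm hab)
  have hd := Bool.eq_not_of_ne (Ne.symm hcd)
  -- Both paths now have ends in different facets; each is oriented to start in the facet of `r₁`.
  rcases Bool.eq_or_eq_not (a i) (r₁ i) with ha | ha <;>
    rcases Bool.eq_or_eq_not (c i) (r₁ i) with hc | hc <;>
    simp only [ha, hc, Bool.not_not] at hb hd
  · exact fin a b c d hE ha hb hc hd
  · exact (fin a b d c hE.swap_pairs.swap_left.swap_pairs ha hb hd
      hc).swap_pairs.swap_left.swap_pairs
  · exact (fin b a c d hE.swap_left hb ha hc hd).swap_left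
  · exact (fin b a d c hE.swap_left.swap_pairs.swap_left.swap_pairs hb ha
      hd hc).swap_pairs.swap_left.swap_pairs.swap_left

/-! ### Dimension four: an exhaustive search

The vertices of `Q_4` are encoded by the numbers below `16`, sets of vertices by bit masks. -/

/-- The vertex of `Q_4` with code `k`. -/
def vtx (k : ℕ) : Vertex 4 := fun i => k.testBit i

/-- The set of vertex codes given by the mask `m`. -/
def codes (m : ℕ) : Finset ℕ := {k ∈ Finset.range 16 | m.testBit k}

/-- Passes the mask `m` without the code `y` to `cont`, provided that `y` belongs to `m`. -/
def take (m y : ℕ) (cont : ℕ → Bool) : Bool :=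
  Nat.beq (Nat.land (Nat.shiftRight m y) 1) 1 && cont (Nat.xor m (Nat.pow 2 y))

/-- Searches for a path from `u` to `v` through vertices in the mask `m` such that the unused part
of `m` satisfies `cont`; the number `k` bounds the length of the path. -/
def search : ℕ → ℕ → ℕ → ℕ → (ℕ → Bool) → Bool
  | 0, _, _, _, _ => false
  | k + 1, m, u, v, cont =>
    bif Nat.beq u v then cont m else
      [1, 2, 4, 8].any fun i => take m (Nat.xor u i) fun m' => search k m' (Nat.xor u i) v cont

/-- Searches for two paths that link `a` to `b` and `c` to `d` and cover all vertices of `Q_4`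
except those with codes `0` and `r`. -/
def searchPair (r a b c d : ℕ) : Bool :=
  take 65535 0 fun m => take m r fun m => take m a fun m => take m c fun m => take m d fun m =>
    search 16 m a b fun m' => take (Nat.xor m' (Nat.pow 2 d)) d fun _ =>
      search 16 (Nat.xor m' (Nat.pow 2 d)) c d fun m'' => Nat.beq m'' 0

theorem take_sound {m y : ℕ} {cont : ℕ → Bool} (hy : y < 16) (h : take m y cont = true) :
    (codes m).val = y ::ₘ (codes (m ^^^ 2 ^ y)).val ∧ cont (m ^^^ 2 ^ y) = true := by
  rw [take, Bool.and_eq_true] at h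
  obtain ⟨h₁, h₂⟩ := h
  refine ⟨?_, h₂⟩
  have hb : m.testBit y = true := by
    have := Nat.eq_of_beq_eq_true h₁
    change (m >>> y) &&& 1 = 1 at this
    rw [Nat.testBit, Nat.and_comm, this]
    rfl
  have hn : y ∉ codes (m ^^^ 2 ^ y) := by simp [codes, hb]
  rw [← Finset.cons_val hn]
  congr 1
  ext k
  by_cases hk : k = y
  · subst hk; simp [codes, hb, hy]
  · simp [codes, hk, Nat.testBit_two_pow_of_ne (Ne.symm hk)]

theorem vtx_adj_xor : ∀ u < 16, ∀ i ∈ [1, 2, 4, 8],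
    (u ^^^ i) < 16 ∧ (cube 4).Adj (vtx u) (vtx (u ^^^ i)) := by
  decide

/-- The start `u` is already missing from the mask, and each step moves one code from the mask to
the list. The multiset identity records this and so certifies that no vertex is repeated. -/
theorem search_sound {k m u v : ℕ} {cont : ℕ → Bool} (hu : u < 16)
    (h : search k m u v cont = true) :
    ∃ l m', Links (cube 4) l (vtx u) (vtx v) ∧ cont m' = true ∧
      (l : Multiset (Vertex 4)) + (codes m').val.map vtx = vtx u ::ₘ (codes m).val.map vtx := by
  induction k generalizing m u with
  | zero => exact absurd h (by simp [search])
  | succ k ih =>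
    rw [search] at h
    by_cases huv : u = v
    · subst huv
      rw [Nat.beq_refl, cond_true] at h
      exact ⟨_, m, Links.singleton _, h, by simp⟩
    · rw [Bool.eq_false_iff.2 fun h => huv (Nat.eq_of_beq_eq_true h), cond_false,
        List.any_eq_true] at h
      obtain ⟨i, hi, h⟩ := h
      obtain ⟨hlt, hadj⟩ := vtx_adj_xor u hu i hi
      obtain ⟨hm, h⟩ := take_sound hlt h
      obtain ⟨l, m', hl, hc, he⟩ := ih hlt h
      refine ⟨_, m', (Links.singleton _).append hl hadj, hc, ?_⟩
      rw [hm, Multiset.map_cons]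
      erw [← he]
      rw [← Multiset.coe_add, add_assoc]
      simp

theorem codes_zero : codes 0 = ∅ := by decide

theorem map_codes_univ : (codes 65535).val.map vtx = Finset.univ.val := by decide +kernel

theorem isLinked_of_searchPair {r a b c d : ℕ} (hr : r < 16) (ha : a < 16) (hc : c < 16)
    (hd : d < 16) (h : searchPair r a b c d = true) :
    IsLinked (vtx 0) (vtx r) (vtx a) (vtx b) (vtx c) (vtx d) := by
  rw [searchPair] at h
  obtain ⟨h₀, h⟩ := take_sound (by omega) h
  obtain ⟨h₁, h⟩ := take_sound hr h
  obtain ⟨h₂, h⟩ := take_sound ha h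
  obtain ⟨h₃, h⟩ := take_sound hc h
  obtain ⟨h₄, h⟩ := take_sound hd h
  obtain ⟨l, m', hl, h, he⟩ := search_sound ha h
  -- The code `d` was withheld so that the first path avoids it. This test certifies that flipping
  -- its bit in `m'` really puts it back.
  obtain ⟨h₅, h⟩ := take_sound hd h
  obtain ⟨l', m'', hl', h, he'⟩ := search_sound hc h
  obtain rfl : m'' = 0 := Nat.eq_of_beq_eq_true h
  refine ⟨l, l', hl, hl', ?_⟩
  change (codes (m' ^^^ 2 ^ d)).val = d ::ₘ (codes (m' ^^^ 2 ^ d ^^^ 2 ^ d)).val at h₅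
  rw [Nat.xor_assoc, Nat.xor_self, Nat.xor_zero] at h₅
  change _ = vtx c ::ₘ Multiset.map vtx (codes (m' ^^^ 2 ^ d)).val at he'
  rw [codes_zero, h₅] at he'
  simp only [Finset.empty_val, Multiset.map_zero, add_zero, Multiset.map_cons] at he'
  rw [← map_codes_univ, h₀, h₁, h₂, h₃, h₄]
  simp only [Multiset.map_cons, ← Multiset.cons_coe, ← Multiset.coe_add]
  rw [he', Multiset.add_cons, Multiset.add_cons, he, Multiset.cons_swap (vtx d) (vtx a),
    Multiset.cons_swap (vtx c) (vtx a)]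

/-- The lists are the nonzero codes of even weight and the codes of odd weight. Reversing either
path and exchanging the two allows `a < b`, `c < d` and `a < c`, which leaves 7 · 210 searches. -/
theorem searchPair_eq_true : ∀ r ∈ [3, 5, 6, 9, 10, 12, 15],
    ∀ a ∈ [1, 2, 4, 7, 8, 11, 13, 14], ∀ b ∈ [1, 2, 4, 7, 8, 11, 13, 14], a < b →
    ∀ c ∈ [1, 2, 4, 7, 8, 11, 13, 14], a < c → c ≠ b →
    ∀ d ∈ [1, 2, 4, 7, 8, 11, 13, 14], c < d → d ≠ b → searchPair r a b c d = true := by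
  decide +kernel

theorem isLinked_vtx {r a b c d : ℕ} (hr : r ∈ [3, 5, 6, 9, 10, 12, 15])
    (ha : a ∈ [1, 2, 4, 7, 8, 11, 13, 14]) (hb : b ∈ [1, 2, 4, 7, 8, 11, 13, 14])
    (hc : c ∈ [1, 2, 4, 7, 8, 11, 13, 14]) (hd : d ∈ [1, 2, 4, 7, 8, 11, 13, 14])
    (hnd : [a, b, c, d].Nodup) :
    IsLinked (vtx 0) (vtx r) (vtx a) (vtx b) (vtx c) (vtx d) := by
  have hlt : ∀ k ∈ [1, 2, 4, 7, 8, 11, 13, 14], k < 16 := by decide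
  have hlt' : ∀ k ∈ [3, 5, 6, 9, 10, 12, 15], k < 16 := by decide
  simp only [List.nodup_cons, List.mem_cons, List.not_mem_nil, or_false, not_or] at hnd
  obtain ⟨⟨hab, hac, had⟩, ⟨hbc, hbd⟩, hcd, -⟩ := hnd
  wlog h₁ : a < b generalizing a b
  · exact (this hb ha (by omega) hbc hbd hac had (by omega)).swap_left
  wlog h₂ : c < d generalizing c d
  · exact (this hd hc (by omega) had hac hbd hbc (by omega)).swap_pairs.swap_left.swap_pairs
  wlog h₃ : a < c generalizing a b c d
  · refine IsLinked.swap_pairs ?_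
    apply this <;> first | assumption | omega
  exact isLinked_of_searchPair (hlt' r hr) (hlt a ha) (hlt c hc) (hlt d hd)
    (searchPair_eq_true r hr a ha b hb h₁ c hc h₃ (Ne.symm hbc) d hd h₂ (Ne.symm hbd))

theorem exists_vtx : ∀ x : Vertex 4, ∃ k < 16, x = vtx k := by decide +kernel

theorem mem_of_parity_vtx_eq : ∀ k < 16, vtx 0 ≠ vtx k → parity (vtx 0) = parity (vtx k) →
    k ∈ [3, 5, 6, 9, 10, 12, 15] := by
  decide +kernel

theorem mem_of_parity_vtx_ne : ∀ k < 16, parity (vtx k) ≠ parity (vtx 0) →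
    k ∈ [1, 2, 4, 7, 8, 11, 13, 14] := by
  decide +kernel

/-! ### Translations -/

/-- The translation of the cube by `w`. -/
def translate {n : ℕ} (w x : Vertex n) : Vertex n := fun i => w i ^^ x i

theorem translate_involutive {n : ℕ} (w : Vertex n) : Function.Involutive (translate w) := by
  intro x
  funext i
  simp [translate]

theorem translate_self {n : ℕ} (w : Vertex n) : translate w w = fun _ => false := by
  funext i
  simp [translate]

theorem translate_injective {n : ℕ} (w : Vertex n) : Function.Injective (translate w) :=
  (translate_involutive w).injective

theorem hammingDist_translate {n : ℕ} (w x y : Vertex n) :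
    hammingDist (translate w x) (translate w y) = hammingDist x y :=
  hammingDist_comp (fun i b => w i ^^ b) fun i b c h => by simpa using h

/-- A translation by an odd word exchanges the colours, so only comparisons of parities are
invariant. `IsEndChoice` accordingly compares with `parity r₁` and names no colour. -/
theorem parity_translate_eq {n : ℕ} (w x y : Vertex n) :
    parity (translate w x) = parity (translate w y) ↔ parity x = parity y := by
  rw [parity_eq_parity_iff, parity_eq_parity_iff, hammingDist_translate]

theorem IsEndChoice.translate {n : ℕ} {r₁ r₂ a b c d : Vertex n}
    (h : IsEndChoice r₁ r₂ a b c d) (w : Vertex n) :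
    IsEndChoice (translate w r₁) (translate w r₂) (translate w a) (translate w b)
      (translate w c) (translate w d) := by
  obtain ⟨h₁, h₂, h₃, h₄, h₅, h₆, h₇⟩ := h
  refine ⟨(translate_injective w).ne h₁, ?_, ?_, ?_, ?_, ?_, h₇.map (translate_injective w)⟩ <;>
    simpa only [Ne, parity_translate_eq]

theorem IsLinked.of_translate {n : ℕ} {r₁ r₂ a b c d : Vertex n} (w : Vertex n)
    (h : IsLinked (translate w r₁) (translate w r₂) (translate w a) (translate w b)
      (translate w c) (translate w d)) :
    IsLinked r₁ r₂ a b c d := by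
  obtain ⟨l, l', hl, hl', hu⟩ := h
  have hadj : ∀ x y, (cube n).Adj x y →
      (cube n).Adj (HypercubePaths.translate w x) (HypercubePaths.translate w y) := by
    intro x y
    rw [cube_adj, cube_adj, hammingDist_translate]
    exact id
  have hl := hl.map _ hadj
  have hl' := hl'.map _ hadj
  rw [translate_involutive w, translate_involutive w] at hl hl'
  refine ⟨_, _, hl, hl', ?_⟩
  have hmap := congrArg (Multiset.map (HypercubePaths.translate w)) hu
  rw [Multiset.map_coe] at hmap
  rw [← Multiset.map_univ_val_equiv (translate_involutive w).toPerm]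
  simpa [translate_involutive w _] using hmap

theorem isTwoLaceable_four : IsTwoLaceable 4 := by
  intro r₁ r₂ a b c d hE
  refine IsLinked.of_translate r₁ ?_
  have hE := hE.translate r₁
  rw [show translate r₁ r₁ = vtx 0 by rw [translate_self]; funext i; simp [vtx]] at hE ⊢
  obtain ⟨r, hr, hr'⟩ := exists_vtx (translate r₁ r₂)
  obtain ⟨a', ha, ha'⟩ := exists_vtx (translate r₁ a)
  obtain ⟨b', hb, hb'⟩ := exists_vtx (translate r₁ b)
  obtain ⟨c', hc, hc'⟩ := exists_vtx (translate r₁ c)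
  obtain ⟨d', hd, hd'⟩ := exists_vtx (translate r₁ d)
  rw [hr', ha', hb', hc', hd'] at hE ⊢
  exact isLinked_vtx (mem_of_parity_vtx_eq r hr hE.ne hE.parity_eq)
    (mem_of_parity_vtx_ne a' ha hE.parity_a) (mem_of_parity_vtx_ne b' hb hE.parity_b)
    (mem_of_parity_vtx_ne c' hc hE.parity_c) (mem_of_parity_vtx_ne d' hd hE.parity_d)
    (List.Nodup.of_map vtx hE.nodup)

theorem isTwoLaceable {n : ℕ} (hn : 4 ≤ n) : IsTwoLaceable n := by
  induction n, hn using Nat.le_induction with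
  | base => exact isTwoLaceable_four
  | succ n hn ih => exact isTwoLaceable_succ hn ih

/-! ### From lists to path coverings -/

theorem Links.exists_endedPath_induce {V : Type*} {G : SimpleGraph V} {l : List V} {u v : V}
    (h : Links G l u v) (hnd : l.Nodup) (S : Set V) (hS : ∀ x ∈ l, x ∈ S) :
    ∃ p : EndedPath (G.induce S),
      p.walk.support.map Subtype.val = l ∧ p.ends.map Subtype.val = s(u, v) := by
  lift l to List S using hS
  obtain ⟨hc, hh, ht⟩ := h
  have hne : l ≠ [] := by rintro rfl; simp at hh
  replace hc : l.IsChain (G.induce S).Adj :=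
    (List.isChain_map (R := G.Adj) (Subtype.val : S → V)).1 hc
  refine ⟨⟨_, _, SimpleGraph.Walk.ofSupport l hne hc, ?_⟩, ?_, ?_⟩
  · rw [SimpleGraph.Walk.isPath_def, SimpleGraph.Walk.support_ofSupport]
    exact hnd.of_map
  · rw [SimpleGraph.Walk.support_ofSupport]
  · rw [List.head?_map, List.head?_eq_some_head hne] at hh
    rw [List.getLast?_map, List.getLast?_eq_some_getLast hne] at ht
    rw [EndedPath.ends, Sym2.map_mk]
    exact congrArg₂ (fun x y => s(x, y)) (Option.some.inj hh) (Option.some.inj ht)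

theorem IsTwoLaceable.twoPathClaim {n : ℕ} (h : IsTwoLaceable n) (red : Bool) :
    TwoPathClaim red n := by
  classical
  intro r₁ r₂ g₁ g₂ g₃ g₄ hr₁ hr₂ hr hg₁ hg₂ hg₃ hg₄ h₁₂ h₁₃ h₁₄ h₂₃ h₂₄ h₃₄
  subst hr₁
  obtain ⟨l, l', hl, hl', hu⟩ := h r₁ r₂ g₁ g₂ g₃ g₄
    ⟨hr, hr₂.symm, hg₁, hg₂, hg₃, hg₄, by simp [*]⟩
  have hnd : (r₁ :: r₂ :: (l ++ l')).Nodup := by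
    rw [← Multiset.coe_nodup, hu]
    exact Finset.univ.nodup
  have hmem : ∀ x, x ∈ r₁ :: r₂ :: (l ++ l') := by
    intro x
    rw [← Multiset.mem_coe, hu]
    exact Finset.mem_univ x
  simp only [List.nodup_cons, List.mem_cons, List.mem_append, not_or, List.nodup_append] at hnd
  obtain ⟨⟨-, h₁l, h₁l'⟩, ⟨h₂l, h₂l'⟩, hndl, hndl', hdisj⟩ := hnd
  obtain ⟨p, hp, hpe⟩ := hl.exists_endedPath_induce hndl
    {x | x ∉ ({r₁, r₂} : Finset (Vertex n))} (by rintro x hx; simp; grind)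
  obtain ⟨q, hq, hqe⟩ := hl'.exists_endedPath_induce hndl'
    {x | x ∉ ({r₁, r₂} : Finset (Vertex n))} (by rintro x hx; simp; grind)
  have hpq : ∀ v, v ∈ p.walk.support → v ∉ q.walk.support := fun v hv hv' =>
    hdisj v (hp ▸ List.mem_map_of_mem hv) v (hq ▸ List.mem_map_of_mem hv') rfl
  have hne : p ≠ q := by
    rintro rfl
    exact hpq _ p.walk.start_mem_support p.walk.start_mem_support
  refine ⟨{p, q}, ⟨⟨?_, ?_⟩, Finset.card_pair hne⟩, ⟨p, by simp, hpe⟩, ⟨q, by simp, hqe⟩⟩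
  · intro p' hp' q' hq' hne' v hv hv'
    rw [Finset.mem_insert, Finset.mem_singleton] at hp' hq'
    rcases hp' with rfl | rfl <;> rcases hq' with rfl | rfl
    · exact hne' rfl
    · exact hpq v hv hv'
    · exact hpq v hv' hv
    · exact hne' rfl
  · rintro ⟨v, hv⟩
    have hv' := hmem v
    simp only [Finset.mem_insert, Finset.mem_singleton, not_or] at hv
    simp only [List.mem_cons, List.mem_append, hv.1, hv.2, false_or] at hv'
    rcases hv' with hv' | hv'
    · rw [← hp] at hv'
      obtain ⟨x, hx, rfl⟩ := List.mem_map.1 hv'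
      exact ⟨p, by simp, hx⟩
    · rw [← hq] at hv'
      obtain ⟨x, hx, rfl⟩ := List.mem_map.1 hv'
      exact ⟨q, by simp, hx⟩

/-! ### An obstruction in dimension three -/

theorem EndedPath.exists_walk {n : ℕ} {F : Finset (Vertex n)} (p : EndedPath (cubeMinus F))
    {u v : Vertex n} (h : cubeEnds p = s(u, v)) :
    ∃ (x y : {x : Vertex n // x ∉ F}) (w : (cubeMinus F).Walk x y), w.IsPath ∧ x.1 = u ∧ y.1 = v ∧
      ∀ z, z ∈ w.support ↔ z ∈ p.walk.support := by
  rw [cubeEnds, EndedPath.ends, Sym2.map_mk, Sym2.eq_iff] at h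
  rcases h with ⟨h₁, h₂⟩ | ⟨h₁, h₂⟩
  · exact ⟨_, _, p.walk, p.isPath, h₁, h₂, fun _ => Iff.rfl⟩
  · exact ⟨_, _, p.walk.reverse, p.isPath.reverse, h₂, h₁, fun z => by simp⟩

/-- If `s` is the only neighbour of `g₁` outside the fault and the other neighbours of `s` are the
ends `g₃`, `g₄` of another path, then no path of the covering connects `g₁` to `g₂`. -/
theorem not_isPathCovering {n : ℕ} {r₁ r₂ s g₁ g₂ g₃ g₄ : Vertex n}
    (h₁ : ∀ v, (cube n).Adj g₁ v → v = r₁ ∨ v = r₂ ∨ v = s)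
    (h₂ : ∀ v, (cube n).Adj s v → v = g₁ ∨ v = g₃ ∨ v = g₄)
    (h₁₂ : g₁ ≠ g₂) (hs : s ≠ g₂) (h₁₃ : g₁ ≠ g₃) (h₁₄ : g₁ ≠ g₄)
    {C : Finset (EndedPath (cubeMinus {r₁, r₂}))} (hC : IsPathCovering (cubeMinus {r₁, r₂}) C)
    {p q : EndedPath (cubeMinus {r₁, r₂})} (hp : p ∈ C) (hq : q ∈ C)
    (hpe : cubeEnds p = s(g₁, g₂)) (hqe : cubeEnds q = s(g₃, g₄)) : False := by
  have hne : p ≠ q := by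
    rintro rfl
    rw [hpe, Sym2.eq_iff] at hqe
    tauto
  have hd := hC.disjoint p hp q hq hne
  obtain ⟨x, y, w, hw, hx, hy, hsup⟩ := p.exists_walk hpe
  obtain ⟨x', y', w', -, hx', hy', hsup'⟩ := q.exists_walk hqe
  match w, hw, hsup with
  | .nil, _, _ => exact h₁₂ (hx.symm.trans hy)
  | .cons (v := v) ha .nil, _, _ =>
    have hv := v.2
    rcases h₁ v.1 (hx ▸ ha) with h | h | h
    · simp [h] at hv
    · simp [h] at hv
    · exact hs (h.symm.trans hy)
  | .cons (v := v) ha (.cons (v := z) hb w), hw, hsup =>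
    have hv := v.2
    rcases h₁ v.1 (hx ▸ ha) with h | h | h
    · simp [h] at hv
    · simp [h] at hv
    -- The path has reached `s`; its next vertex `z` is either `g₁` again or an end of the disjoint
    -- path `q`.
    · have hz : z ∈ p.walk.support := (hsup z).1 (by simp)
      rcases h₂ z.1 (h ▸ hb) with h' | h' | h'
      · have hzx : z = x := Subtype.ext (h'.trans hx.symm)
        subst hzx
        rw [SimpleGraph.Walk.cons_isPath_iff] at hw
        exact hw.2 (by simp)
      · have hzx : z = x' := Subtype.ext (h'.trans hx'.symm)
        exact hd z hz ((hsup' z).1 (hzx ▸ w'.start_mem_support))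
      · have hzy : z = y' := Subtype.ext (h'.trans hy'.symm)
        exact hd z hz ((hsup' z).1 (hzy ▸ w'.end_mem_support))

/-- In `Q_3` there are ends for which the cube without two vertices of parity `red` cannot be
covered by linking paths. -/
theorem exists_obstruction (red : Bool) :
    ∃ r₁ r₂ g₁ g₂ g₃ g₄ : Vertex 3,
      (parity r₁ = red ∧ parity r₂ = red ∧ r₁ ≠ r₂ ∧
      parity g₁ ≠ red ∧ parity g₂ ≠ red ∧ parity g₃ ≠ red ∧ parity g₄ ≠ red ∧
      g₁ ≠ g₂ ∧ g₁ ≠ g₃ ∧ g₁ ≠ g₄ ∧ g₂ ≠ g₃ ∧ g₂ ≠ g₄ ∧ g₃ ≠ g₄) ∧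
      ∀ C : Finset (EndedPath (cubeMinus {r₁, r₂})), IsPathCovering (cubeMinus {r₁, r₂}) C →
        ∀ p ∈ C, ∀ q ∈ C, cubeEnds p = s(g₁, g₂) → cubeEnds q ≠ s(g₃, g₄) := by
  have key : ∀ red : Bool, ∃ r₁ r₂ s g₁ g₂ g₃ g₄ : Vertex 3,
      (parity r₁ = red ∧ parity r₂ = red ∧ r₁ ≠ r₂ ∧
      parity g₁ ≠ red ∧ parity g₂ ≠ red ∧ parity g₃ ≠ red ∧ parity g₄ ≠ red ∧
      g₁ ≠ g₂ ∧ g₁ ≠ g₃ ∧ g₁ ≠ g₄ ∧ g₂ ≠ g₃ ∧ g₂ ≠ g₄ ∧ g₃ ≠ g₄) ∧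
      (∀ v, (cube 3).Adj g₁ v → v = r₁ ∨ v = r₂ ∨ v = s) ∧
      (∀ v, (cube 3).Adj s v → v = g₁ ∨ v = g₃ ∨ v = g₄) ∧ s ≠ g₂ := by
    -- The vertices `r₁`, `r₂`, `s` are the neighbours of `g₁`, while `g₁`, `g₃`, `g₄` are those of
    -- `s`, and `g₂` is the antipode of `s`. The second choice is the first with the first
    -- coordinate flipped.
    rintro (_ | _)
    · exact ⟨![false, false, true], ![false, true, false], ![true, true, true],
        ![false, true, true], ![false, false, false], ![true, false, true], ![true, true, false],
        by decide +kernel⟩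
    · exact ⟨![true, false, true], ![true, true, false], ![false, true, true],
        ![true, true, true], ![true, false, false], ![false, false, true], ![false, true, false],
        by decide +kernel⟩
  obtain ⟨r₁, r₂, s, g₁, g₂, g₃, g₄, h, h₁, h₂, hs⟩ := key red
  refine ⟨r₁, r₂, g₁, g₂, g₃, g₄, h, fun C hC p hp q hq hpe hqe => ?_⟩
  obtain ⟨-, -, -, -, -, -, -, h₁₂, h₁₃, h₁₄, -⟩ := h
  exact not_isPathCovering h₁ h₂ h₁₂ hs h₁₃ h₁₄ hC hp hq hpe hqe

theorem not_twoPathClaim_three (red : Bool) : ¬ TwoPathClaim red 3 := by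
  intro h
  obtain ⟨r₁, r₂, g₁, g₂, g₃, g₄, ⟨h₁, h₂, h₃, h₄, h₅, h₆, h₇, h₈, h₉, h₁₀, h₁₁, h₁₂, h₁₃⟩, hno⟩ :=
    exists_obstruction red
  obtain ⟨C, hC, ⟨p, hp, hpe⟩, q, hq, hqe⟩ :=
    h r₁ r₂ g₁ g₂ g₃ g₄ h₁ h₂ h₃ h₄ h₅ h₆ h₇ h₈ h₉ h₁₀ h₁₁ h₁₂ h₁₃
  exact hno C hC.1 p hp q hq hpe hqe

/-! ### Prescribing ends freely -/

theorem pairOfParity_mk {n : ℕ} {b : Bool} {x y : Vertex n} :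
    PairOfParity b s(x, y) ↔ parity x = b ∧ parity y = b := by
  simp [PairOfParity]

theorem isNeutralPair_mk {n : ℕ} {x y : Vertex n} :
    IsNeutralPair s(x, y) ↔ parity x ≠ parity y := by
  simp only [IsNeutralPair, Sym2.mem_iff]
  constructor
  · rintro ⟨u, rfl | rfl, v, rfl | rfl, h⟩
    · exact absurd rfl h
    · exact h
    · exact h.symm
    · exact absurd rfl h
  · exact fun h => ⟨x, Or.inl rfl, y, Or.inr rfl, h⟩

theorem isChargedPair_iff_not_isNeutralPair {n : ℕ} (e : Sym2 (Vertex n)) :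
    IsChargedPair e ↔ ¬ IsNeutralPair e := by
  induction e using Sym2.ind with
  | _ x y =>
    rw [isNeutralPair_mk, not_not]
    simp only [IsChargedPair, pairOfParity_mk]
    exact ⟨fun ⟨_, h, h'⟩ => h.trans h'.symm, fun h => ⟨_, h, rfl⟩⟩

/-- The parity counts of a fault consisting of two vertices of parity `red`. -/
theorem parityCount_pair {n : ℕ} {r₁ r₂ : Vertex n} {red : Bool} (hr : r₁ ≠ r₂)
    (h₁ : parity r₁ = red) (h₂ : parity r₂ = red) :
    parityCount red {r₁, r₂} = 2 ∧ parityCount (!red) {r₁, r₂} = 0 := by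
  constructor
  · rw [parityCount, Finset.filter_true_of_mem (by simp [h₁, h₂]), Finset.card_pair hr]
  · rw [parityCount, Finset.filter_false_of_mem (by simp [h₁, h₂]), Finset.card_empty]

theorem charge_pair {n : ℕ} {r₁ r₂ : Vertex n} (hr : r₁ ≠ r₂) (h : parity r₁ = parity r₂) :
    charge {r₁, r₂} = 2 := by
  obtain ⟨h₁, h₂⟩ := parityCount_pair hr h rfl
  rw [charge]
  cases hp : parity r₂ <;> rw [hp] at h₁ h₂ <;> simp at h₂ <;> rw [h₁, h₂] <;> rfl

theorem exists_of_charge_eq_two {n : ℕ} {F : Finset (Vertex n)} (hF : F.card = 2)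
    (hc : charge F = 2) : ∃ r₁ r₂, r₁ ≠ r₂ ∧ parity r₁ = parity r₂ ∧ F = {r₁, r₂} := by
  obtain ⟨r₁, r₂, hr, rfl⟩ := Finset.card_eq_two.1 hF
  refine ⟨r₁, r₂, hr, ?_, rfl⟩
  by_contra hp
  have h : ∀ b, parityCount b ({r₁, r₂} : Finset (Vertex n)) = 1 := by
    intro b
    rw [parityCount, Finset.filter_insert, Finset.filter_singleton]
    generalize parity r₁ = p at *
    generalize parity r₂ = q at *
    cases b <;> cases p <;> cases q <;> simp_all
  rw [charge, h, h] at hc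
  simp at hc

/-- The admissible sets of two charged pairs for a fault of two vertices of the same
parity. -/
theorem isAdmissible_pair_iff {n : ℕ} {r₁ r₂ : Vertex n} (hr : r₁ ≠ r₂)
    (hp : parity r₁ = parity r₂) (E : Finset (Sym2 (Vertex n))) :
    IsAdmissible {r₁, r₂} 0 2 E ↔
      IsPairSet E ∧ E.card = 2 ∧ ∀ e ∈ E, PairOfParity (!parity r₁) e := by
  have hcount : ∀ b, pairCount b E ≤ E.card := by
    intro b
    rw [← Set.ncard_coe_finset]
    exact Set.ncard_le_ncard (fun e he => he.1) E.finite_toSet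
  have hall : ∀ b, pairCount b E = E.card ↔ ∀ e ∈ E, PairOfParity b e := by
    intro b
    rw [← Set.ncard_coe_finset]
    constructor
    · intro h e he
      have := Set.eq_of_subset_of_ncard_le (s := {e | e ∈ E ∧ PairOfParity b e}) (t := ↑E)
        (fun e he => he.1) h.ge E.finite_toSet
      rw [← Finset.mem_coe, ← this] at he
      exact he.2
    · intro h
      rw [pairCount]
      congr 1
      ext e
      simpa using h e
  obtain ⟨h₁, h₂⟩ := parityCount_pair hr rfl hp.symm
  have hbal : ((parityCount true {r₁, r₂} : ℤ) - parityCount false {r₁, r₂} =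
      (pairCount false E : ℤ) - pairCount true E) ↔
      (pairCount (!parity r₁) E : ℤ) - pairCount (parity r₁) E = 2 := by
    generalize parity r₁ = red at h₁ h₂
    cases red <;> simp only [Bool.not_true, Bool.not_false] at h₁ h₂ ⊢ <;> rw [h₁, h₂] <;> omega
  have hcharged : (∀ e ∈ E, IsChargedPair e) → {e | e ∈ E ∧ IsChargedPair e}.ncard = E.card := by
    intro h
    rw [← Set.ncard_coe_finset]
    congr 1
    ext e
    simpa using h e
  rw [IsAdmissible, InBalance, hbal]
  constructor
  · rintro ⟨hE, ⟨-, hb⟩, hN, hO⟩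
    have hfin : {e | e ∈ E ∧ IsNeutralPair e}.Finite :=
      E.finite_toSet.subset fun e he => he.1
    rw [Set.ncard_eq_zero hfin, Set.eq_empty_iff_forall_notMem] at hN
    rw [hcharged fun e he => (isChargedPair_iff_not_isNeutralPair e).2 fun h => hN e ⟨he, h⟩] at hO
    -- Balance requires two more pairs of the opposite parity than of the parity of `r₁`, and there
    -- are only two pairs in all.
    refine ⟨hE, hO, (hall _).1 (le_antisymm (hcount _) ?_)⟩
    omega
  · rintro ⟨hE, hcard, h⟩
    have hch : ∀ e ∈ E, IsChargedPair e := fun e he => ⟨_, h e he⟩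
    refine ⟨hE, ⟨fun e he x hx hxF => ?_, ?_⟩, ?_, by rw [hcharged hch, hcard]⟩
    · have hx := h e he x hx
      rw [Finset.mem_insert, Finset.mem_singleton] at hxF
      rcases hxF with rfl | rfl
      · simp at hx
      · simp [hp] at hx
    · rw [(hall _).2 h, hcard]
      have : pairCount (parity r₁) E = 0 := by
        rw [pairCount, Set.ncard_eq_zero (E.finite_toSet.subset fun e he => he.1),
          Set.eq_empty_iff_forall_notMem]
        rintro e ⟨he, he'⟩
        induction e using Sym2.ind with
        | _ x y =>
          have := (pairOfParity_mk.1 he').1.symm.trans (pairOfParity_mk.1 (h _ he)).1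
          simp at this
      rw [this]
      rfl
    · rw [Set.ncard_eq_zero (E.finite_toSet.subset fun e he => he.1),
        Set.eq_empty_iff_forall_notMem]
      rintro e ⟨he, he'⟩
      exact (isChargedPair_iff_not_isNeutralPair e).1 (hch e he) he'

/-- Four different vertices of the parity opposite to the fault form an admissible pair set. -/
theorem isAdmissible_of_isEndChoice {n : ℕ} {r₁ r₂ a b c d : Vertex n}
    (h : IsEndChoice r₁ r₂ a b c d) : IsAdmissible {r₁, r₂} 0 2 {s(a, b), s(c, d)} := by
  obtain ⟨hr, hp, ha, hb, hc, hd, hnd⟩ := h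
  simp only [List.nodup_cons, List.mem_cons, List.not_mem_nil, or_false, not_or] at hnd
  obtain ⟨⟨hab, hac, had⟩, ⟨hbc, hbd⟩, hcd, -⟩ := hnd
  have hne : s(a, b) ≠ s(c, d) := by
    rw [Ne, Sym2.eq_iff]
    tauto
  rw [isAdmissible_pair_iff hr hp]
  refine ⟨⟨?_, ?_⟩, Finset.card_pair hne, ?_⟩
  · simp [hab, hcd]
  · have hdis : ∀ x, x ∈ s(a, b) → x ∉ s(c, d) := by
      intro x
      rw [Sym2.mem_iff, Sym2.mem_iff]
      rintro (rfl | rfl) <;> tauto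
    intro e he e' he' hee x hx hx'
    rw [Finset.mem_insert, Finset.mem_singleton] at he he'
    rcases he with rfl | rfl <;> rcases he' with rfl | rfl
    · exact hee rfl
    · exact hdis x hx hx'
    · exact hdis x hx' hx
    · exact hee rfl
  · intro e he
    rw [Finset.mem_insert, Finset.mem_singleton] at he
    rcases he with rfl | rfl <;> rw [pairOfParity_mk]
    · exact ⟨Bool.eq_not_of_ne ha, Bool.eq_not_of_ne hb⟩
    · exact ⟨Bool.eq_not_of_ne hc, Bool.eq_not_of_ne hd⟩

/-- Free prescription also demands that some admissible set exists; four neighbours of `r₁` provide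
the ends. -/
theorem exists_isAdmissible {n : ℕ} (hn : 4 ≤ n) {r₁ r₂ : Vertex n} (hr : r₁ ≠ r₂)
    (hp : parity r₁ = parity r₂) : ∃ E, IsAdmissible {r₁, r₂} 0 2 E := by
  have hpar : ∀ i, parity (flip r₁ i) ≠ parity r₁ := fun i => (parity_ne_of_adj (adj_flip r₁ i)).symm
  refine ⟨_, isAdmissible_of_isEndChoice (a := flip r₁ ⟨0, by omega⟩) (b := flip r₁ ⟨1, by omega⟩)
    (c := flip r₁ ⟨2, by omega⟩) (d := flip r₁ ⟨3, by omega⟩)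
    ⟨hr, hp, hpar _, hpar _, hpar _, hpar _, ?_⟩⟩
  simp [(flip_injective r₁).eq_iff]

theorem canFreelyPrescribeEnds_pair {n : ℕ} (hn : 4 ≤ n) {r₁ r₂ : Vertex n} (hr : r₁ ≠ r₂)
    (hp : parity r₁ = parity r₂) : CanFreelyPrescribeEnds {r₁, r₂} 0 2 := by
  classical
  refine ⟨exists_isAdmissible hn hr hp, fun E hE => ?_⟩
  rw [isAdmissible_pair_iff hr hp] at hE
  obtain ⟨⟨hdiag, hdis⟩, hcard, hpar⟩ := hE
  obtain ⟨e, e', hne, rfl⟩ := Finset.card_eq_two.1 hcard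
  obtain ⟨a, b, rfl⟩ : ∃ a b, e = s(a, b) := by
    induction e using Sym2.ind with
    | _ a b => exact ⟨a, b, rfl⟩
  obtain ⟨c, d, rfl⟩ : ∃ c d, e' = s(c, d) := by
    induction e' using Sym2.ind with
    | _ c d => exact ⟨c, d, rfl⟩
  have hd := hdis s(a, b) (by simp) s(c, d) (by simp) hne
  have hda := hd a (by simp)
  have hdb := hd b (by simp)
  simp only [Sym2.mem_iff, not_or] at hda hdb
  have hab : a ≠ b := by simpa using hdiag s(a, b) (by simp)
  have hcd : c ≠ d := by simpa using hdiag s(c, d) (by simp)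
  obtain ⟨ha, hb⟩ := pairOfParity_mk.1 (hpar s(a, b) (by simp))
  obtain ⟨hc, hd⟩ := pairOfParity_mk.1 (hpar s(c, d) (by simp))
  obtain ⟨C, ⟨hC, hC₂⟩, ⟨p, hpC, hpe⟩, q, hqC, hqe⟩ :=
    (isTwoLaceable hn).twoPathClaim (parity r₁) r₁ r₂ a b c d rfl hp.symm hr
      (by simp [ha]) (by simp [hb]) (by simp [hc]) (by simp [hd]) hab hda.1 hda.2 hdb.1 hdb.2 hcd
  have hpq : p ≠ q := by
    rintro rfl
    exact hne (hpe.symm.trans hqe)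
  -- The end pairs must be exactly those of `E`, so it matters that the covering has no third path.
  have hCpq : {p, q} = C := by
    refine Finset.eq_of_subset_of_card_le ?_ (by rw [hC₂, Finset.card_pair hpq])
    simp [Finset.insert_subset_iff, hpC, hqC]
  refine ⟨C, hC, ?_⟩
  subst hCpq
  ext e
  simp [hpe, hqe, eq_comm]

theorem isLeast_admissibleDims : IsLeast (admissibleDims 2 2 0 2) 4 := by
  constructor
  · refine ⟨?_, fun n hn F hF hc => ?_⟩
    -- The logarithm is that of 8, so this bound alone would still allow the value 3.
    · rw [Real.logb_le_iff_le_rpow (by norm_num) (by norm_num)]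
      norm_num
    · obtain ⟨r₁, r₂, hr, hp, rfl⟩ := exists_of_charge_eq_two hF hc
      exact canFreelyPrescribeEnds_pair hn hr hp
  · rintro m ⟨-, hm⟩
    -- A value below 4 would include dimension 3, where the obstruction, with either colour as red,
    -- gives an admissible set that is not realised.
    by_contra hlt
    obtain ⟨r₁, r₂, g₁, g₂, g₃, g₄,
      ⟨h₁, h₂, hr, h₄, h₅, h₆, h₇, h₈, h₉, h₁₀, h₁₁, h₁₂, h₁₃⟩, hno⟩ := exists_obstruction true
    have hp : parity r₁ = parity r₂ := h₁.trans h₂.symm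
    rw [← h₁] at h₄ h₅ h₆ h₇
    obtain ⟨C, hC, hE⟩ := (hm 3 (by omega) {r₁, r₂} (Finset.card_pair hr) (charge_pair hr hp)).2 _
      (isAdmissible_of_isEndChoice (a := g₁) (b := g₂) (c := g₃) (d := g₄)
        ⟨hr, hp, h₄, h₅, h₆, h₇, by simp [*]⟩)
    obtain ⟨p, hpC, hpe⟩ : s(g₁, g₂) ∈ {e | ∃ p ∈ C, cubeEnds p = e} := by rw [hE]; simp
    obtain ⟨q, hqC, hqe⟩ : s(g₃, g₄) ∈ {e | ∃ p ∈ C, cubeEnds p = e} := by rw [hE]; simp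
    exact hno C hC p hpC q hqC hpe hqe

end HypercubePaths

theorem mainTheorem10 :
    (∀ (red : Bool) (n : ℕ), 4 ≤ n → HypercubePaths.TwoPathClaim red n) ∧
    (∀ red : Bool, ¬ HypercubePaths.TwoPathClaim red 3) ∧
    IsLeast (HypercubePaths.admissibleDims 2 2 0 2) 4 :=
  ⟨fun red _ hn => (HypercubePaths.isTwoLaceable hn).twoPathClaim red,
    HypercubePaths.not_twoPathClaim_three, HypercubePaths.isLeast_admissibleDims⟩
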